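/- Let $I$ be a finite weighted undirected graph (parallel edges allowed, no self-loops) with $n=|V(I)|$ vertices and positive edge resistances $r_e$. For a graph $G$ let $L_G=\sum_{e\in E(G)} r_e^{-1} b_eb_e^T$ be its Laplacian, where $b_e\in\mathbb R^{V(G)}$ is the signed indicator vector of $e$ ($1$ on one endpoint, $-1$ on the other, $0$ elsewhere), let $L_G^+$ be the pseudoinverse of $L_G$, and let $\mathrm{lev}_G(e)=b_e^TL_G^+b_e/r_e$. Let $Z\subseteq E(I)$ satisfy, with $\tau=\frac{1}{10000\log n}$ ($Z$ is empty if $n\le 1$, and then there is nothing to check): * (Initial leverage scores) $\mathrm{lev}_I(e)\in[3/16,13/16]$ for all $e\in Z$; * (Initial localization) $\sum_{f\in Z,\,f\ne e}\frac{|b_e^TL_I^+b_f|}{\sqrt{r_e}\sqrt{r_f}}\le\tau$ for all $e\in Z$. Let $I_0=I$, $Z_0=Z$ and, for $k=0,1,\dots,|Z|-1$, let $e_k$ be uniformly random in $Z_k$ conditionally on all earlier edges and decisions, let $I_{k+1}$ be either $I_k\setminus e_k$ ($e_k$ deleted) or $I_k/e_k$ (endpoints of $e_k$ identified, self-loops removed),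 where the decision is arbitrary (it may depend on the past, on $e_k$ and on additional randomness, but later edges remain uniform given it), and let $Z_{k+1}=Z_k\setminus\{e_k\}$. Then with probability at least $1-1/n^2$ the following holds simultaneously for all $0\le k\le|Z|$: * $Z_k\subseteq E(I_k)$; * (All leverage scores) $\mathrm{lev}_{I_k}(e)\in[1/8,7/8]$ for all $e\in Z_k$; * (All localization) $\sum_{f\in Z_k,\,f\ne e}\frac{|b_e^TL_{I_k}^+b_f|}{\sqrt{r_e}\sqrt{r_f}}\le 2\tau$ for all $e\in Z_k$. -/

import Mathlib

open MeasureTheory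

/-- A finite weighted undirected multigraph without self-loops. Vertices and edges are labelled by
elements of `V` and `E`; each edge carries an arbitrary orientation (`head`, `tail`) and a positive
resistance `res e = 1 / w_e`. -/
structure WGraph (V E : Type*) where
  verts : Finset V
  edges : Finset E
  head : E → V
  tail : E → V
  res : E → ℝ
  head_mem : ∀ e ∈ edges, head e ∈ verts
  tail_mem : ∀ e ∈ edges, tail e ∈ verts
  loopless : ∀ e ∈ edges, head e ≠ tail e
  res_pos : ∀ e ∈ edges, 0 < res e

namespace WGraph

section
variable {V E : Type*} [DecidableEq V]

/-- The signed indicator vector `b_e ∈ ℝ^{V(G)}`: `1` on the head of `e`, `-1` on its tail. -/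
def b (G : WGraph V E) (e : E) : G.verts → ℝ := fun u =>
  (if (u : V) = G.head e then 1 else 0) - (if (u : V) = G.tail e then 1 else 0)

/-- The Laplacian `L_G = Bᵀ W B = ∑ₑ w_e b_e b_eᵀ`, where `w_e = 1 / r_e`. -/
noncomputable def lap (G : WGraph V E) : Matrix G.verts G.verts ℝ :=
  ∑ e ∈ G.edges, (1 / G.res e) • Matrix.vecMulVec (G.b e) (G.b e)

theorem lap_isHermitian (G : WGraph V E) : G.lap.IsHermitian := by
  unfold Matrix.IsHermitian lap
  ext i j
  simp only [Matrix.conjTranspose_apply, Matrix.sum_apply, Matrix.smul_apply,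
    Matrix.vecMulVec_apply, star_trivial, smul_eq_mul]
  exact Finset.sum_congr rfl fun e _ => by ring

/-- The pseudoinverse `L_G⁺ = ∑ (1 / λ_i) u_i u_iᵀ`, the sum running over an orthonormal basis of
eigenvectors `u_i` of `L_G`, restricted to those with nonzero eigenvalue `λ_i`. -/
noncomputable def lapPinv (G : WGraph V E) : Matrix G.verts G.verts ℝ :=
  ∑ i, if G.lap_isHermitian.eigenvalues i = 0 then 0 else
    (1 / G.lap_isHermitian.eigenvalues i) •
      Matrix.vecMulVec (fun u => G.lap_isHermitian.eigenvectorBasis i u)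
        (fun u => G.lap_isHermitian.eigenvectorBasis i u)

/-- The number `b_eᵀ L_G⁺ b_f`. -/
noncomputable def form (G : WGraph V E) (e f : E) : ℝ :=
  G.b e ⬝ᵥ (G.lapPinv.mulVec (G.b f))

/-- The leverage score `lev_G(e) = b_eᵀ L_G⁺ b_e / r_e`. -/
noncomputable def lev (G : WGraph V E) (e : E) : ℝ :=
  G.form e e / G.res e

/-- The localization sum of `e` with respect to `Z`:
`∑_{f ∈ Z, f ≠ e} |b_eᵀ L_G⁺ b_f| / (√r_e √r_f)`. -/
noncomputable def locSum [DecidableEq E] (G : WGraph V E) (Z : Finset E) (e : E) : ℝ :=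
  ∑ f ∈ Z.erase e, |G.form e f| / (√(G.res e) * √(G.res f))

/-- `G \ e`: the graph with the edge `e` deleted. -/
def deleteEdge [DecidableEq E] (G : WGraph V E) (e : E) : WGraph V E where
  verts := G.verts
  edges := G.edges.erase e
  head := G.head
  tail := G.tail
  res := G.res
  head_mem f hf := G.head_mem f (Finset.mem_of_mem_erase hf)
  tail_mem f hf := G.tail_mem f (Finset.mem_of_mem_erase hf)
  loopless f hf := G.loopless f (Finset.mem_of_mem_erase hf)
  res_pos f hf := G.res_pos f (Finset.mem_of_mem_erase hf)

/-- The map of vertices that identifies the tail of `e` with its head. -/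
def identify (G : WGraph V E) (e : E) (v : V) : V :=
  if v = G.tail e then G.head e else v

/-- `G / e`: the two endpoints of `e` are identified to a single vertex, and all self-loops
(including `e` itself and every edge parallel to `e`) are removed. -/
def contractEdge (G : WGraph V E) (e : E) : WGraph V E where
  verts := G.verts.image (G.identify e)
  edges := G.edges.filter fun f => G.identify e (G.head f) ≠ G.identify e (G.tail f)
  head f := G.identify e (G.head f)
  tail f := G.identify e (G.tail f)
  res := G.res
  head_mem f hf := Finset.mem_image_of_mem _ (G.head_mem f (Finset.mem_filter.mp hf).1)
  tail_mem f hf := Finset.mem_image_of_mem _ (G.tail_mem f (Finset.mem_filter.mp hf).1)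
  loopless _ hf := (Finset.mem_filter.mp hf).2
  res_pos f hf := G.res_pos f (Finset.mem_filter.mp hf).1

/-- The minor `I_k` obtained from `I_0 = I` by processing the edges `a 0, …, a (k - 1)` in this
order, where `a j` is contracted if `c j = true` and deleted if `c j = false`. -/
def minorSeq [DecidableEq E] (I : WGraph V E) (a : ℕ → E) (c : ℕ → Bool) : ℕ → WGraph V E
  | 0 => I
  | k + 1 =>
    if c k = true then (minorSeq I a c k).contractEdge (a k)
    else (minorSeq I a c k).deleteEdge (a k)

end

end WGraph

/-- `Z_k = Z \ {a 0, …, a (k - 1)}`. -/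
def remainingEdges {E : Type*} [DecidableEq E] (Z : Finset E) (a : ℕ → E) (k : ℕ) : Finset E :=
  Z \ (Finset.range k).image a

/-- The event that the first `k` processed edges and the first `k` contraction/deletion decisions
are `a 0, …, a (k - 1)` and `d 0, …, d (k - 1)`. -/
def historyEvent {Ω E : Type*} (e : ℕ → Ω → E) (c : ℕ → Ω → Bool) (k : ℕ)
    (a : ℕ → E) (d : ℕ → Bool) : Set Ω :=
  {ω | ∀ j < k, e j ω = a j ∧ c j ω = d j}

/-- The random edges `e 0, e 1, …` are removed from `Z` one at a time, uniformly at random, with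
arbitrary decisions `c 0, c 1, …`: as long as edges remain (`k < |Z|`), conditionally on any history
of edges and decisions before time `k`, the edge `e k` is uniformly distributed on the set of
remaining edges. Nothing is required of the decisions `c k`, so that `c k` may depend in any way on
the history, on `e k`, and on additional randomness. Since the uniformity of `e k` is required given
all earlier decisions, decisions cannot anticipate later edges. -/
structure IsRandomRemoval {Ω E : Type*} [MeasurableSpace Ω] [DecidableEq E] (μ : Measure Ω)
    (Z : Finset E) (e : ℕ → Ω → E) (c : ℕ → Ω → Bool) : Prop where
  measurable_edge : ∀ (k : ℕ) (x : E), MeasurableSet {ω | e k ω = x}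
  measurable_decision : ∀ k : ℕ, Measurable (c k)
  uniform : ∀ k < Z.card, ∀ (a : ℕ → E) (d : ℕ → Bool), ∀ x ∈ remainingEdges Z a k,
    μ.real (historyEvent e c k a d ∩ {ω | e k ω = x}) =
      μ.real (historyEvent e c k a d) / ((remainingEdges Z a k).card : ℝ)

/-!
The conclusion holds almost surely, whatever the decisions are: the randomness only serves to ensure
that the processed edges are distinct elements of `Z`.

Write `M e f = b_eᵀ L⁺ b_f / (√r_e √r_f)`, so that `M e e = lev e`. Removing an edge `g` changes `M`
by a rank-one term, `M' e f = M e f + s * M e g * M g f`, with `s = 1 / (1 - lev g)` for a deletion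
(`form_deleteEdge`) and `s = -1 / lev g` for a contraction (`form_contractEdge`). Both formulas come
from the weak form of the equation `L X = b_f` for potentials `X` (`IsPotential`), where contraction
just composes test functions with the identification of vertices.

As long as leverage scores stay in `[1/8, 7/8]`, `|s| ≤ 8`. If every localization sum `S` is at most
`τ`, the sum at `e` loses the term `|M e g|` and gains at most `8 τ |M e g|`. Hence it decreases, by
at least `(1 - 8 τ) |M e g|`, while the leverage score of `e` moves by at most
`8 (M e g)² ≤ 8 τ |M e g|`. The total drift of a leverage score is therefore at most
`16 τ (τ - S) ≤ 16 τ²`, far below the available `1/16`. This is the invariant `Controlled`, preserved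
by `Controlled.step`. Finally, edges of `Z` never become self-loops, since parallel edges would have
an entry `M e g` of size at least `1/8 > τ` (`nform_sq_of_parallel`).
-/

/-! ### The pseudoinverse and potentials -/

open Finset Matrix in
/-- `L` annihilates the range of `1 - L L⁺`. Read off termwise from the spectral decomposition, as
`λ * (λ * λ⁻¹) = λ`. -/
theorem WGraph.lap_mul_lap_mul_lapPinv {V E : Type*} [DecidableEq V] (G : WGraph V E) :
    G.lap * (G.lap * G.lapPinv) = G.lap := by
  set hA := G.lap_isHermitian
  have hv : ∀ i, G.lap *ᵥ (fun u => hA.eigenvectorBasis i u) =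
      hA.eigenvalues i • (fun u => hA.eigenvectorBasis i u) := fun i =>
    hA.mulVec_eigenvectorBasis i
  have h1 : G.lap = ∑ i, hA.eigenvalues i •
      vecMulVec (fun u => hA.eigenvectorBasis i u) (fun u => hA.eigenvectorBasis i u) := by
    conv_lhs => rw [hA.spectral_theorem]
    ext a b
    simp [Unitary.conjStarAlgAut_apply, mul_apply, diagonal_apply, Matrix.sum_apply,
      vecMulVec_apply, star_eq_conjTranspose, Matrix.IsHermitian.eigenvectorUnitary_apply]
    exact sum_congr rfl fun i _ => by ring
  conv_rhs => rw [h1]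
  unfold lapPinv
  rw [Matrix.mul_sum, Matrix.mul_sum]
  refine sum_congr rfl fun i _ => ?_
  split_ifs with h
  · simp [h]
  · rw [Matrix.mul_smul, Matrix.mul_smul, mul_vecMulVec, hv, smul_vecMulVec, Matrix.mul_smul,
      mul_vecMulVec, hv, smul_vecMulVec, smul_smul, smul_smul]
    congr 1
    field_simp

namespace WGraph

section
variable {V E : Type*}

/-- The potential difference of `X : V → ℝ` across the edge `e`. -/
def drop (G : WGraph V E) (X : V → ℝ) (e : E) : ℝ := X (G.head e) - X (G.tail e)

/-- `X` solves `L_G X = b_f`, in weak form: tested against every `Y : V → ℝ`. Potentials live on all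
of `V`, so that a potential of a minor can be compared with one of the graph. -/
def IsPotential (G : WGraph V E) (f : E) (X : V → ℝ) : Prop :=
  ∀ Y : V → ℝ, ∑ g ∈ G.edges, 1 / G.res g * (G.drop Y g * G.drop X g) = G.drop Y f

/-- A family of numbers with zero energy vanishes on every edge, as resistances are positive. -/
theorem eq_zero_of_energy_eq_zero (G : WGraph V E) (d : E → ℝ)
    (h : ∑ g ∈ G.edges, 1 / G.res g * (d g * d g) = 0) {e : E} (he : e ∈ G.edges) : d e = 0 := by
  have h0 := (Finset.sum_eq_zero_iff_of_nonneg fun g hg =>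
    mul_nonneg (one_div_pos.2 (G.res_pos g hg)).le (mul_self_nonneg (d g))).1 h e he
  have := G.res_pos e he
  simpa [this.ne'] using h0

variable [DecidableEq V]

theorem b_dotProduct (G : WGraph V E) {e : E} (he : e ∈ G.edges) (X : V → ℝ) :
    G.b e ⬝ᵥ (fun u : G.verts => X u) = G.drop X e := by
  have key : ∀ v ∈ G.verts, ∑ u : G.verts, (if (u : V) = v then 1 else 0) * X u = X v := by
    intro v hv
    rw [Finset.sum_eq_single (⟨v, hv⟩ : G.verts)]
    · simp
    · intro u _ hu
      rw [if_neg fun h => hu (Subtype.ext h), zero_mul]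
    · simp
  simp only [dotProduct, b, drop, sub_mul, Finset.sum_sub_distrib]
  rw [key _ (G.head_mem e he), key _ (G.tail_mem e he)]

theorem dotProduct_lap_mulVec (G : WGraph V E) (y x : G.verts → ℝ) :
    y ⬝ᵥ G.lap.mulVec x = ∑ g ∈ G.edges, 1 / G.res g * ((G.b g ⬝ᵥ y) * (G.b g ⬝ᵥ x)) := by
  unfold lap
  rw [Matrix.sum_mulVec, dotProduct_sum]
  refine Finset.sum_congr rfl fun g _ => ?_
  rw [Matrix.smul_mulVec, Matrix.vecMulVec_mulVec, dotProduct_smul]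
  simp only [op_smul_eq_smul, dotProduct_smul, smul_eq_mul]
  rw [dotProduct_comm y]
  ring

theorem dotProduct_lap_comm (G : WGraph V E) (y x : G.verts → ℝ) :
    y ⬝ᵥ G.lap.mulVec x = G.lap.mulVec y ⬝ᵥ x := by
  rw [dotProduct_comm (G.lap.mulVec y), dotProduct_lap_mulVec, dotProduct_lap_mulVec]
  exact Finset.sum_congr rfl fun _ _ => by ring

/-- Edge vectors lie in the range of the Laplacian: they are orthogonal to its kernel. -/
theorem lap_mulVec_lapPinv_mulVec_b (G : WGraph V E) {f : E} (hf : f ∈ G.edges) :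
    G.lap.mulVec (G.lapPinv.mulVec (G.b f)) = G.b f := by
  set p := G.lapPinv.mulVec (G.b f) with hp
  set z := G.b f - G.lap.mulVec p with hz
  have hLz : G.lap.mulVec z = 0 := by
    rw [hz, Matrix.mulVec_sub, hp, Matrix.mulVec_mulVec, Matrix.mulVec_mulVec,
      Matrix.mul_assoc, lap_mul_lap_mul_lapPinv, sub_self]
  have hbz : G.b f ⬝ᵥ z = 0 := by
    refine G.eq_zero_of_energy_eq_zero (fun g => G.b g ⬝ᵥ z) ?_ hf
    rw [← dotProduct_lap_mulVec, hLz, dotProduct_zero]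
  have hzz : z ⬝ᵥ z = 0 := by
    conv_lhs => rw [hz, sub_dotProduct, ← hz]
    rw [hbz, ← dotProduct_lap_comm, hLz, dotProduct_zero, sub_zero]
  exact (sub_eq_zero.1 (dotProduct_self_eq_zero.1 hzz)).symm

theorem exists_isPotential (G : WGraph V E) {f : E} (hf : f ∈ G.edges) :
    ∃ X, G.IsPotential f X ∧ ∀ e ∈ G.edges, G.form e f = G.drop X e := by
  set p := G.lapPinv.mulVec (G.b f) with hp
  let X : V → ℝ := fun v => if h : v ∈ G.verts then p ⟨v, h⟩ else 0
  have hX : (fun u : G.verts => X u) = p := by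
    ext u
    simp [X]
  refine ⟨X, fun Y => ?_, fun e he => ?_⟩
  · have h := G.dotProduct_lap_mulVec (fun u => Y u) (fun u => X u)
    rw [hX, hp, G.lap_mulVec_lapPinv_mulVec_b hf, dotProduct_comm, G.b_dotProduct hf, ← hp,
      ← hX] at h
    rw [h]
    exact Finset.sum_congr rfl fun g hg => by rw [G.b_dotProduct hg, G.b_dotProduct hg]
  · rw [← G.b_dotProduct he, hX]
    rfl

/-- Any potential of `f` computes `b_eᵀ L⁺ b_f`, as two potentials differ by a function without
energy. -/
theorem IsPotential.form_eq {G : WGraph V E} {f : E} {X : V → ℝ} (hX : G.IsPotential f X)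
    (hf : f ∈ G.edges) {e : E} (he : e ∈ G.edges) : G.form e f = G.drop X e := by
  obtain ⟨X', hX', h⟩ := G.exists_isPotential hf
  rw [h e he]
  refine sub_eq_zero.1 (G.eq_zero_of_energy_eq_zero (fun g => G.drop X' g - G.drop X g) ?_ he)
  have h1 := hX' (X' - X)
  rw [← hX (X' - X), ← sub_eq_zero, ← Finset.sum_sub_distrib] at h1
  rw [← h1]
  exact Finset.sum_congr rfl fun g _ => by simp only [drop, Pi.sub_apply]; ring

theorem form_comm (G : WGraph V E) {e f : E} (he : e ∈ G.edges) (hf : f ∈ G.edges) :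
    G.form e f = G.form f e := by
  obtain ⟨X, hX, hXf⟩ := G.exists_isPotential he
  obtain ⟨Y, hY, hYf⟩ := G.exists_isPotential hf
  rw [hYf e he, hXf f hf, ← hX Y, ← hY X]
  exact Finset.sum_congr rfl fun _ _ => by ring

/-! ### Deletion and contraction -/

/-- Rank-one update of the form under deletion (Sherman–Morrison). -/
theorem form_deleteEdge [DecidableEq E] (G : WGraph V E) {g e f : E} (hg : g ∈ G.edges)
    (he : e ∈ G.edges) (hf : f ∈ G.edges) (heg : e ≠ g) (hfg : f ≠ g) (hlev : G.lev g ≠ 1) :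
    (G.deleteEdge g).form e f =
      G.form e f + 1 / (1 - G.lev g) / G.res g * (G.form e g * G.form g f) := by
  obtain ⟨X, hX, hXf⟩ := G.exists_isPotential hf
  obtain ⟨Y, hY, hYf⟩ := G.exists_isPotential hg
  have hr := (G.res_pos g hg).ne'
  have hl : 1 - G.lev g ≠ 0 := sub_ne_zero.2 hlev.symm
  set t := 1 / (1 - G.lev g) / G.res g * G.form g f with ht
  have hpot : (G.deleteEdge g).IsPotential f (X + t • Y) := by
    intro T
    have h1 := hX T
    have h2 := hY T
    rw [← Finset.add_sum_erase _ _ hg] at h1 h2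
    have h3 : ∑ x ∈ G.edges.erase g, 1 / G.res x * (G.drop T x * G.drop (X + t • Y) x) =
        ∑ x ∈ G.edges.erase g, 1 / G.res x * (G.drop T x * G.drop X x) +
        t * ∑ x ∈ G.edges.erase g, 1 / G.res x * (G.drop T x * G.drop Y x) := by
      rw [Finset.mul_sum, ← Finset.sum_add_distrib]
      refine Finset.sum_congr rfl fun x _ => ?_
      simp only [drop, Pi.add_apply, Pi.smul_apply, smul_eq_mul]
      ring
    change ∑ x ∈ G.edges.erase g, 1 / G.res x * (G.drop T x * G.drop (X + t • Y) x) = G.drop T f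
    rw [h3, eq_sub_of_add_eq' h1, eq_sub_of_add_eq' h2, ← hXf g hg, ← hYf g hg]
    have h4 : t * (1 - G.form g g / G.res g) = G.form g f / G.res g := by
      change t * (1 - G.lev g) = _
      rw [ht]
      field_simp
    linear_combination G.drop T g * h4
  rw [hpot.form_eq (Finset.mem_erase.2 ⟨hfg, hf⟩) (Finset.mem_erase.2 ⟨heg, he⟩)]
  change G.drop (X + t • Y) e = _
  rw [hXf e he, hYf e he]
  simp only [drop, Pi.add_apply, Pi.smul_apply, smul_eq_mul, t]
  ring

/-- Rank-one update of the form under contraction: the potential of `f` is corrected by a multiple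
of that of `g` so as to have no drop across `g`. -/
theorem form_contractEdge (G : WGraph V E) {g e f : E} (hg : g ∈ G.edges)
    (he : e ∈ (G.contractEdge g).edges) (hf : f ∈ (G.contractEdge g).edges)
    (hlev : G.lev g ≠ 0) :
    (G.contractEdge g).form e f =
      G.form e f + (-1 / G.lev g) / G.res g * (G.form e g * G.form g f) := by
  have he' : e ∈ G.edges := (Finset.mem_filter.1 he).1
  have hf' : f ∈ G.edges := (Finset.mem_filter.1 hf).1
  obtain ⟨X, hX, hXf⟩ := G.exists_isPotential hf'
  obtain ⟨Y, hY, hYf⟩ := G.exists_isPotential hg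
  have hr := (G.res_pos g hg).ne'
  have hgg : G.form g g ≠ 0 := fun h => hlev (by simp [lev, h])
  set t := (-1 / G.lev g) / G.res g * G.form g f with ht
  have htg : t * G.form g g = -G.form g f := by
    rw [ht, lev]
    field_simp
  have hid : ∀ T : V → ℝ, G.drop T g = 0 → T ∘ G.identify g = T := by
    intro T hT
    ext v
    simp only [Function.comp_apply, identify]
    split_ifs with h
    · rw [h, sub_eq_zero.1 hT]
    · rfl
  have hdrop : ∀ T : V → ℝ, G.drop (T ∘ G.identify g) g = 0 := by
    intro T
    simp [drop, identify]
  have hW : (X + t • Y) ∘ G.identify g = X + t • Y := by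
    refine hid _ ?_
    have h1 := hXf g hg
    have h2 := hYf g hg
    simp only [drop, Pi.add_apply, Pi.smul_apply, smul_eq_mul] at *
    linear_combination htg - h1 - t * h2
  have hpot : (G.contractEdge g).IsPotential f (X + t • Y) := by
    intro T
    change ∑ x ∈ G.edges.filter fun x => G.identify g (G.head x) ≠ G.identify g (G.tail x),
      1 / G.res x * (G.drop (T ∘ G.identify g) x * G.drop ((X + t • Y) ∘ G.identify g) x) =
        G.drop (T ∘ G.identify g) f
    rw [Finset.sum_filter_of_ne, hW]
    · have h1 := hX (T ∘ G.identify g)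
      have h2 := hY (T ∘ G.identify g)
      rw [hdrop] at h2
      rw [← h1, ← sub_eq_zero, ← mul_zero t, ← h2, Finset.mul_sum, ← Finset.sum_sub_distrib]
      refine Finset.sum_congr rfl fun x _ => ?_
      simp only [drop, Pi.add_apply, Pi.smul_apply, smul_eq_mul]
      ring
    · intro x _ hx hxe
      apply hx
      simp [drop, hxe]
  rw [hpot.form_eq hf he]
  change G.drop ((X + t • Y) ∘ G.identify g) e = _
  rw [hW, hXf e he', hYf e he']
  simp only [drop, Pi.add_apply, Pi.smul_apply, smul_eq_mul, t]
  ring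

/-! ### The deterministic invariant -/

/-- The entry `b_eᵀ L⁺ b_f / (√r_e √r_f)` of the transfer projection matrix. -/
noncomputable def nform (G : WGraph V E) (e f : E) : ℝ := G.form e f / (√(G.res e) * √(G.res f))

theorem nform_self (G : WGraph V E) {e : E} (he : e ∈ G.edges) : G.nform e e = G.lev e := by
  rw [nform, lev, Real.mul_self_sqrt (G.res_pos e he).le]

theorem nform_comm (G : WGraph V E) {e f : E} (he : e ∈ G.edges) (hf : f ∈ G.edges) :
    G.nform e f = G.nform f e := by
  rw [nform, nform, G.form_comm he hf, mul_comm (√_)]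

theorem locSum_eq [DecidableEq E] (G : WGraph V E) (Z : Finset E) (e : E) :
    G.locSum Z e = ∑ f ∈ Z.erase e, |G.nform e f| := by
  refine Finset.sum_congr rfl fun f _ => ?_
  rw [nform, abs_div, abs_of_nonneg (mul_nonneg (Real.sqrt_nonneg _) (Real.sqrt_nonneg _))]

theorem abs_nform_le_locSum [DecidableEq E] (G : WGraph V E) {Z : Finset E} {e f : E}
    (hf : f ∈ Z) (hne : f ≠ e) : |G.nform e f| ≤ G.locSum Z e := by
  rw [locSum_eq]
  exact Finset.single_le_sum (f := fun f => |G.nform e f|) (fun _ _ => abs_nonneg _)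
    (Finset.mem_erase.2 ⟨hne, hf⟩)

/-- An edge that contraction of `g` turns into a self-loop is parallel to `g`, and then
`|nform f g|` is the geometric mean of two leverage scores. -/
theorem nform_sq_of_parallel (G : WGraph V E) {f g : E} (hf : f ∈ G.edges) (hg : g ∈ G.edges)
    (h : G.identify g (G.head f) = G.identify g (G.tail f)) :
    G.nform f g ^ 2 = G.lev f * G.lev g := by
  have hloop := G.loopless f hf
  have hpar : ∃ s : ℝ, s ^ 2 = 1 ∧ ∀ T : V → ℝ, G.drop T f = s * G.drop T g := by
    unfold identify at h
    split_ifs at h with h1 h2 h2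
    · exact absurd (h1.trans h2.symm) hloop
    · exact ⟨-1, by norm_num, fun T => by simp only [drop, h1, ← h]; ring⟩
    · exact ⟨1, by norm_num, fun T => by simp only [drop, h2, h]; ring⟩
    · exact absurd h hloop
  obtain ⟨s, hs, hd⟩ := hpar
  obtain ⟨X, hX, hXf⟩ := G.exists_isPotential hg
  have h1 : G.form f g = s * G.form g g := by rw [hXf f hf, hXf g hg, hd]
  have h2 : G.form f f = s * G.form g f := by
    obtain ⟨Y, hY, hYf⟩ := G.exists_isPotential hf
    rw [hYf f hf, hYf g hg, hd]
  rw [G.form_comm hg hf, h1] at h2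
  have hrf := (G.res_pos f hf)
  have hrg := (G.res_pos g hg)
  rw [nform, lev, lev, div_pow, mul_pow, Real.sq_sqrt hrf.le, Real.sq_sqrt hrg.le, h1, h2,
    div_mul_div_comm]
  congr 1
  ring

/-- The deterministic invariant of the process: localization never gets worse than `τ`, and the drift
of a leverage score is paid for by the decrease of the localization sum. -/
structure Controlled [DecidableEq E] (G : WGraph V E) (Z : Finset E) (τ : ℝ) : Prop where
  subset : Z ⊆ G.edges
  loc : ∀ f ∈ Z, G.locSum Z f ≤ τ
  lower : ∀ f ∈ Z, 3 / 16 - 16 * τ * (τ - G.locSum Z f) ≤ G.lev f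
  upper : ∀ f ∈ Z, G.lev f ≤ 13 / 16 + 16 * τ * (τ - G.locSum Z f)

variable [DecidableEq E]

theorem locSum_nonneg (G : WGraph V E) (Z : Finset E) (e : E) : 0 ≤ G.locSum Z e := by
  rw [locSum_eq]
  exact Finset.sum_nonneg fun _ _ => abs_nonneg _

theorem Controlled.lev_mem {G : WGraph V E} {Z : Finset E} {τ : ℝ} (h : G.Controlled Z τ)
    (h1 : τ ≤ 1 / 1000) {f : E} (hf : f ∈ Z) :
    G.lev f ∈ Set.Icc (1 / 8 : ℝ) (7 / 8) := by
  have hl := h.lower f hf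
  have hu := h.upper f hf
  have := G.locSum_nonneg Z f
  have h2 : τ * (τ - G.locSum Z f) ≤ 1 / 1000 * (1 / 1000) :=
    mul_le_mul h1 (by linarith) (by linarith [h.loc f hf]) (by norm_num)
  constructor <;> linarith

/-- Preservation of the invariant under a rank-one update of bounded size. When `g` is removed, the
localization sum of `e` loses `|nform e g|` and gains at most `8 τ |nform e g|`. -/
theorem Controlled.step {G G' : WGraph V E} {Z : Finset E} {τ : ℝ} (h : G.Controlled Z τ)
    (h0 : 0 ≤ τ) (h1 : τ ≤ 1 / 1000) {g : E} (hg : g ∈ Z) (hres : G'.res = G.res)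
    (hsub : Z.erase g ⊆ G'.edges) {s : ℝ} (hs : |s| ≤ 8)
    (hform : ∀ e ∈ Z.erase g, ∀ f ∈ Z.erase g,
      G'.form e f = G.form e f + s / G.res g * (G.form e g * G.form g f)) :
    G'.Controlled (Z.erase g) τ := by
  have hr := G.res_pos g (h.subset hg)
  have hn : ∀ e ∈ Z.erase g, ∀ f ∈ Z.erase g,
      G'.nform e f = G.nform e f + s * (G.nform e g * G.nform g f) := by
    intro e he f hf
    have hre := Real.sqrt_pos.2 (G.res_pos e (h.subset (Finset.mem_of_mem_erase he)))
    have hrf := Real.sqrt_pos.2 (G.res_pos f (h.subset (Finset.mem_of_mem_erase hf)))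
    have hrg := Real.sqrt_pos.2 hr
    rw [nform, hform e he f hf, hres, nform, nform, nform]
    conv_lhs => rw [← Real.mul_self_sqrt hr.le]
    field_simp
  -- The localization sum pays for its own growth.
  have hloc : ∀ e ∈ Z.erase g, G'.locSum (Z.erase g) e + (1 - 8 * τ) * |G.nform e g| ≤
      G.locSum Z e := by
    intro e he
    obtain ⟨heg, heZ⟩ := Finset.mem_erase.1 he
    have hcomm : (Z.erase g).erase e = (Z.erase e).erase g := Finset.erase_right_comm
    have hge : g ∈ Z.erase e := Finset.mem_erase.2 ⟨heg.symm, hg⟩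
    rw [locSum_eq, locSum_eq, ← Finset.add_sum_erase _ _ hge, hcomm]
    have hb : ∑ f ∈ (Z.erase e).erase g, |G'.nform e f| ≤
        ∑ f ∈ (Z.erase e).erase g, (|G.nform e f| + 8 * |G.nform e g| * |G.nform g f|) := by
      refine Finset.sum_le_sum fun f hf => ?_
      rw [← hcomm] at hf
      rw [hn e he f (Finset.mem_of_mem_erase hf)]
      refine (abs_add_le _ _).trans ?_
      rw [abs_mul, abs_mul]
      have := mul_le_mul_of_nonneg_right hs
        (mul_nonneg (abs_nonneg (G.nform e g)) (abs_nonneg (G.nform g f)))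
      linarith
    rw [Finset.sum_add_distrib, ← Finset.mul_sum] at hb
    have hsg : ∑ f ∈ (Z.erase e).erase g, |G.nform g f| ≤ τ := by
      refine le_trans ?_ (h.loc g hg)
      rw [locSum_eq]
      exact Finset.sum_le_sum_of_subset_of_nonneg
        (Finset.erase_subset_erase _ (Finset.erase_subset _ _)) fun _ _ _ => abs_nonneg _
    have := mul_le_mul_of_nonneg_left hsg
      (mul_nonneg (by norm_num : (0 : ℝ) ≤ 8) (abs_nonneg (G.nform e g)))
    linarith
  have hlev : ∀ e ∈ Z.erase g, |G'.lev e - G.lev e| ≤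
      16 * τ * (G.locSum Z e - G'.locSum (Z.erase g) e) := by
    intro e he
    obtain ⟨heg, heZ⟩ := Finset.mem_erase.1 he
    rw [← G'.nform_self (hsub he), ← G.nform_self (h.subset heZ), hn e he e he, add_sub_cancel_left,
      G.nform_comm (h.subset hg) (h.subset heZ), abs_mul, abs_mul]
    have ha := abs_nonneg (G.nform e g)
    have hm : |G.nform e g| ≤ τ :=
      (G.abs_nform_le_locSum hg heg.symm).trans (h.loc e heZ)
    have hb : |s| * (|G.nform e g| * |G.nform e g|) ≤ 8 * (|G.nform e g| * τ) :=
      mul_le_mul hs (mul_le_mul_of_nonneg_left hm ha) (by positivity) (by norm_num)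
    have hc : |G.nform e g| ≤ 2 * (G.locSum Z e - G'.locSum (Z.erase g) e) := by
      nlinarith [hloc e he]
    have := mul_le_mul_of_nonneg_right hc h0
    linarith
  refine ⟨hsub, fun e he => ?_, fun e he => ?_, fun e he => ?_⟩
  · have := mul_nonneg (by linarith : (0 : ℝ) ≤ 1 - 8 * τ) (abs_nonneg (G.nform e g))
    linarith [hloc e he, h.loc e (Finset.mem_of_mem_erase he)]
  · have := abs_le.1 (hlev e he)
    linarith [h.lower e (Finset.mem_of_mem_erase he)]
  · have := abs_le.1 (hlev e he)
    linarith [h.upper e (Finset.mem_of_mem_erase he)]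

theorem Controlled.deleteEdge {G : WGraph V E} {Z : Finset E} {τ : ℝ} (h : G.Controlled Z τ)
    (h0 : 0 ≤ τ) (h1 : τ ≤ 1 / 1000) {g : E} (hg : g ∈ Z) :
    (G.deleteEdge g).Controlled (Z.erase g) τ := by
  obtain ⟨hl, hu⟩ := h.lev_mem h1 hg
  have hpos : 0 < 1 - G.lev g := by linarith
  refine h.step h0 h1 hg rfl (Finset.erase_subset_erase _ h.subset) (s := 1 / (1 - G.lev g)) ?_ ?_
  · rw [abs_of_pos (one_div_pos.2 hpos), div_le_iff₀ hpos]
    linarith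
  · intro e he f hf
    obtain ⟨heg, he⟩ := Finset.mem_erase.1 he
    obtain ⟨hfg, hf⟩ := Finset.mem_erase.1 hf
    exact G.form_deleteEdge (h.subset hg) (h.subset he) (h.subset hf) heg hfg (by linarith)

theorem Controlled.contractEdge {G : WGraph V E} {Z : Finset E} {τ : ℝ} (h : G.Controlled Z τ)
    (h0 : 0 ≤ τ) (h1 : τ ≤ 1 / 1000) {g : E} (hg : g ∈ Z) :
    (G.contractEdge g).Controlled (Z.erase g) τ := by
  obtain ⟨hl, hu⟩ := h.lev_mem h1 hg
  have hpos : 0 < G.lev g := by linarith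
  have hsub : Z.erase g ⊆ (G.contractEdge g).edges := by
    intro f hf
    obtain ⟨hfg, hfZ⟩ := Finset.mem_erase.1 hf
    refine Finset.mem_filter.2 ⟨h.subset hfZ, fun hloop => ?_⟩
    -- A parallel edge would have an entry of size at least `1 / 8 > τ`.
    have hsq := G.nform_sq_of_parallel (h.subset hfZ) (h.subset hg) hloop
    have hm : |G.nform f g| ≤ τ := (G.abs_nform_le_locSum hg hfg.symm).trans (h.loc f hfZ)
    have hfl := (h.lev_mem h1 hfZ).1
    have := mul_le_mul hfl hl (by norm_num) (by linarith)
    rw [← sq_abs] at hsq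
    nlinarith [abs_nonneg (G.nform f g)]
  refine h.step h0 h1 hg rfl hsub (s := -1 / G.lev g) ?_ ?_
  · rw [abs_div, abs_neg, abs_one, abs_of_pos hpos, div_le_iff₀ hpos]
    linarith
  · intro e he f hf
    exact G.form_contractEdge (h.subset hg) (hsub he) (hsub hf) hpos.ne'

end

end WGraph

/-! ### Random removal -/

section
variable {E : Type*} [DecidableEq E]

theorem remainingEdges_zero (Z : Finset E) (a : ℕ → E) : remainingEdges Z a 0 = Z := by
  simp [remainingEdges]

theorem remainingEdges_succ (Z : Finset E) (a : ℕ → E) (k : ℕ) :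
    remainingEdges Z a (k + 1) = (remainingEdges Z a k).erase (a k) := by
  ext x
  simp only [remainingEdges, Finset.mem_sdiff, Finset.mem_image, Finset.mem_range,
    Finset.mem_erase, not_exists, not_and, Nat.lt_succ_iff_lt_or_eq]
  constructor
  · rintro ⟨hx, h⟩
    exact ⟨fun he => h k (Or.inr rfl) he.symm, hx, fun j hj => h j (Or.inl hj)⟩
  · rintro ⟨hne, hx, h⟩
    refine ⟨hx, fun j hj he => ?_⟩
    rcases hj with hj | rfl
    · exact h j hj he
    · exact hne he.symm

theorem remainingEdges_congr (Z : Finset E) {a a' : ℕ → E} {k : ℕ} (h : ∀ j < k, a j = a' j) :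
    remainingEdges Z a k = remainingEdges Z a' k := by
  unfold remainingEdges
  congr 1
  exact Finset.image_congr fun j hj => h j (Finset.mem_range.1 hj)

theorem remainingEdges_card_pos {Z : Finset E} (a : ℕ → E) {k : ℕ} (hk : k < Z.card) :
    0 < (remainingEdges Z a k).card := by
  have h1 := Finset.le_card_sdiff ((Finset.range k).image a) Z
  have h2 : ((Finset.range k).image a).card ≤ k := by
    simpa using Finset.card_image_le (s := Finset.range k) (f := a)
  unfold remainingEdges
  omega

theorem WGraph.Controlled.minorSeq {V : Type*} [DecidableEq V] {I : WGraph V E} {Z : Finset E}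
    {τ : ℝ} (h : I.Controlled Z τ) (h0 : 0 ≤ τ) (h1 : τ ≤ 1 / 1000) {a : ℕ → E} (c : ℕ → Bool)
    {k : ℕ} (ha : ∀ j < k, a j ∈ remainingEdges Z a j) :
    (I.minorSeq a c k).Controlled (remainingEdges Z a k) τ := by
  induction k with
  | zero => simpa [remainingEdges_zero, WGraph.minorSeq] using h
  | succ k ih =>
    have hk := ih fun j hj => ha j (hj.trans k.lt_succ_self)
    rw [remainingEdges_succ, WGraph.minorSeq]
    split_ifs
    · exact hk.contractEdge h0 h1 (ha k k.lt_succ_self)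
    · exact hk.deleteEdge h0 h1 (ha k k.lt_succ_self)

variable {Ω : Type*} [MeasurableSpace Ω] {μ : Measure Ω} {Z : Finset E}
  {e : ℕ → Ω → E} {c : ℕ → Ω → Bool}

/-- Given a history, the probabilities of the remaining edges exhaust that of the history. -/
theorem IsRandomRemoval.ae_mem_of_history [IsProbabilityMeasure μ] (h : IsRandomRemoval μ Z e c)
    {k : ℕ} (hk : k < Z.card) (a : ℕ → E) (d : ℕ → Bool) :
    ∀ᵐ ω ∂μ, ω ∈ historyEvent e c k a d → e k ω ∈ remainingEdges Z a k := by
  set H := historyEvent e c k a d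
  set R := remainingEdges Z a k
  have hR : (0 : ℝ) < (R.card : ℝ) := Nat.cast_pos.2 (remainingEdges_card_pos a hk)
  have hm : ∀ x, MeasurableSet {ω | e k ω = x} := h.measurable_edge k
  set T : Set Ω := ⋃ x ∈ R, {ω | e k ω = x}
  have hT : MeasurableSet T := R.measurableSet_biUnion fun x _ => hm x
  have hsum : μ.real (H ∩ T) = μ.real H := by
    have h1 : (μ.restrict H).real T = ∑ x ∈ R, (μ.restrict H).real {ω | e k ω = x} :=
      measureReal_biUnion_finset (fun x _ y _ hxy => Set.disjoint_left.2 fun ω hx hy =>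
        hxy (hx.symm.trans hy)) fun x _ => hm x
    rw [measureReal_restrict_apply hT, Set.inter_comm] at h1
    rw [h1, Finset.sum_congr rfl fun x hx => by
      rw [measureReal_restrict_apply (hm x), Set.inter_comm, h.uniform k hk a d x hx],
      Finset.sum_const, nsmul_eq_mul]
    exact mul_div_cancel₀ _ hR.ne'
  have hdiff : μ.real (H \ T) = 0 := by
    have := measureReal_inter_add_sdiff (μ := μ) (s := H) hT
    linarith
  rw [measureReal_eq_zero_iff] at hdiff
  filter_upwards [measure_eq_zero_iff_ae_notMem.1 hdiff] with ω hω hH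
  by_contra hne
  refine hω ⟨hH, fun hωT => hne ?_⟩
  obtain ⟨x, hx, hex⟩ := Set.mem_iUnion₂.1 hωT
  rwa [show e k ω = x from hex]

theorem IsRandomRemoval.ae_mem_remainingEdges [IsProbabilityMeasure μ]
    (h : IsRandomRemoval μ Z e c) {k : ℕ} (hk : k ≤ Z.card) :
    ∀ᵐ ω ∂μ, ∀ j < k, e j ω ∈ remainingEdges Z (e · ω) j := by
  induction k with
  | zero => simp
  | succ k ih =>
    obtain ⟨z, hz⟩ := Finset.card_pos.1 (k.zero_le.trans_lt hk)
    -- Histories within `Z` are finite in number, although `E` may be uncountable.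
    have hall : ∀ᵐ ω ∂μ, ∀ p : (Fin k → Z) × (Fin k → Bool),
        ω ∈ historyEvent e c k (fun j => if hj : j < k then (p.1 ⟨j, hj⟩ : E) else z)
          (fun j => if hj : j < k then p.2 ⟨j, hj⟩ else true) →
        e k ω ∈ remainingEdges Z (fun j => if hj : j < k then (p.1 ⟨j, hj⟩ : E) else z) k :=
      ae_all_iff.2 fun p => h.ae_mem_of_history hk _ _
    filter_upwards [ih (Nat.le_of_succ_le hk), hall] with ω hω hωall j hj
    rcases Nat.lt_succ_iff_lt_or_eq.1 hj with hj | rfl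
    · exact hω j hj
    · have := hωall (fun i => ⟨e i ω, (Finset.mem_sdiff.1 (hω i i.2)).1⟩, fun i => c i ω)
        fun i hi => by simp [hi]
      rwa [remainingEdges_congr Z (a' := (e · ω)) fun i hi => by simp [hi]] at this

end

theorem proposition4p5 {V E Ω : Type*} [DecidableEq V] [DecidableEq E] [MeasurableSpace Ω]
    (I : WGraph V E) (n : ℕ) (hn : n = I.verts.card) (τ : ℝ) (hτ : τ = 1 / (10000 * Real.log n))
    (Z : Finset E) (hZ : Z ⊆ I.edges)
    (hlev : ∀ f ∈ Z, I.lev f ∈ Set.Icc (3 / 16 : ℝ) (13 / 16))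
    (hloc : ∀ f ∈ Z, I.locSum Z f ≤ τ)
    (μ : Measure Ω) [IsProbabilityMeasure μ] (e : ℕ → Ω → E) (c : ℕ → Ω → Bool)
    (hec : IsRandomRemoval μ Z e c) :
    1 - 1 / (n : ℝ) ^ 2 ≤
      μ.real {ω | ∀ k ≤ Z.card,
        remainingEdges Z (e · ω) k ⊆ (I.minorSeq (e · ω) (c · ω) k).edges ∧
        (∀ f ∈ remainingEdges Z (e · ω) k,
          (I.minorSeq (e · ω) (c · ω) k).lev f ∈ Set.Icc (1 / 8 : ℝ) (7 / 8)) ∧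
        (∀ f ∈ remainingEdges Z (e · ω) k,
          (I.minorSeq (e · ω) (c · ω) k).locSum (remainingEdges Z (e · ω) k) f ≤ 2 * τ)} := by
  have hτ0 : 0 ≤ τ := by
    rw [hτ]
    exact one_div_nonneg.2 (mul_nonneg (by norm_num) (Real.log_natCast_nonneg n))
  have hτ1 : τ ≤ 1 / 1000 := by
    rw [hτ]
    rcases lt_or_ge n 2 with h | h
    · -- For `n ≤ 1` the logarithm vanishes, and `τ = 1 / 0 = 0`.
      interval_cases n <;> simp
    · have h2 : Real.log 2 ≤ Real.log n := Real.log_le_log (by norm_num) (by exact_mod_cast h)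
      have h3 := Real.log_two_gt_d9
      exact one_div_le_one_div_of_le (by norm_num) (by linarith)
  have hI : I.Controlled Z τ := by
    have hd : ∀ f ∈ Z, 0 ≤ 16 * τ * (τ - I.locSum Z f) := fun f hf =>
      mul_nonneg (by linarith) (sub_nonneg.2 (hloc f hf))
    exact ⟨hZ, hloc, fun f hf => by linarith [(hlev f hf).1, hd f hf],
      fun f hf => by linarith [(hlev f hf).2, hd f hf]⟩
  have hone : ∀ {s : Set Ω}, (∀ᵐ ω ∂μ, ω ∈ s) → 1 - 1 / (n : ℝ) ^ 2 ≤ μ.real s := by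
    intro s hs
    have h1 : μ.real s = 1 := by
      rw [measureReal_congr (Filter.eventuallyEq_univ (s := s) |>.2 hs), probReal_univ]
    rw [h1]
    exact sub_le_self _ (by positivity)
  refine hone ?_
  filter_upwards [hec.ae_mem_remainingEdges le_rfl] with ω hω k hk
  have hc := hI.minorSeq hτ0 hτ1 (c · ω) fun j hj => hω j (hj.trans_le hk)
  exact ⟨hc.subset, fun f hf => hc.lev_mem hτ1 hf,
    fun f hf => (hc.loc f hf).trans (by linarith)⟩
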